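/- Let $\mathbf B_3=\langle\sigma_1,\sigma_2\mid\sigma_1\sigma_2\sigma_1=\sigma_2\sigma_1\sigma_2\rangle$ be the braid group on three strings and let $e:\mathbf B_3\to\mathbb Z$ be the homomorphism with $e(\sigma_1)=e(\sigma_2)=1$. A quasipositive factorization of $X\in\mathbf B_3$ is a tuple $(X_1,\dots,X_k)\in\mathbf B_3^k$ such that $X_1\cdots X_k=X$ and every $X_i$ is conjugate to $\sigma_1$ in $\mathbf B_3$. For a group $G$ and $k\ge 0$, the Hurwitz action of the braid group $\mathbf B_k$ on $G^k$ is the action in which the standard generator $\sigma_i$ ($1\le i<k$) sends $(X_1,\dots,X_k)$ to $(X_1,\dots,X_{i-1},\,X_iX_{i+1}X_i^{-1},\,X_i,\,X_{i+2},\dots,X_k)$; for $G=\mathbf B_3$ it preserves the set of quasipositive factorizations of any given $X$. **Theorem 3.** If $X\in\mathbf B_3$ and $e(X)=2$, then the quasipositive factorizations of $X$ form at most two orbits of the Hurwitz action. -/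

import Mathlib

/-- The defining relators of the Artin braid group on `n` strings, as words in the free group on the
generators `σ_1, …, σ_{n-1}` (the generator `σ_{i+1}` is indexed by `i : Fin (n - 1)`). -/
def braidRelators (n : ℕ) : Set (FreeGroup (Fin (n - 1))) :=
  {r | ∃ i j : Fin (n - 1), (i : ℕ) + 1 = (j : ℕ) ∧
      r = FreeGroup.of i * FreeGroup.of j * FreeGroup.of i *
        (FreeGroup.of j * FreeGroup.of i * FreeGroup.of j)⁻¹} ∪
  {r | ∃ i j : Fin (n - 1), (i : ℕ) + 1 < (j : ℕ) ∧
      r = FreeGroup.of i * FreeGroup.of j * (FreeGroup.of j * FreeGroup.of i)⁻¹}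

/-- The Artin braid group on `n` strings (trivial for `n = 0, 1`). -/
abbrev BraidGroup (n : ℕ) : Type := PresentedGroup (braidRelators n)

/-- The braid group `B₃ = ⟨σ₁, σ₂ ∣ σ₁σ₂σ₁ = σ₂σ₁σ₂⟩`. -/
abbrev B3 : Type := BraidGroup 3

/-- The standard generator `σ₁` of `B₃`. -/
def sigma1 : B3 := PresentedGroup.of (0 : Fin 2)

/-- The exponent sum `e : B_n → ℤ`, the homomorphism sending every standard generator to `1`. -/
def exponentSum (n : ℕ) : BraidGroup n →* Multiplicative ℤ :=
  PresentedGroup.toGroup (rels := braidRelators n) (f := fun _ => Multiplicative.ofAdd 1) (by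
    rintro r (⟨i, j, -, rfl⟩ | ⟨i, j, -, rfl⟩) <;> simp)

/-- The position `i` (of the positions `i`, `i + 1`) in a `k`-tuple. -/
def leftPos {k : ℕ} (i : Fin (k - 1)) : Fin k := ⟨i, by omega⟩

/-- The position `i + 1` (of the positions `i`, `i + 1`) in a `k`-tuple. -/
def rightPos {k : ℕ} (i : Fin (k - 1)) : Fin k := ⟨i + 1, by omega⟩

/-- The elementary Hurwitz move
`Σ_i (X_1, …, X_k) = (X_1, …, X_{i-1}, X_i X_{i+1} X_i⁻¹, X_i, X_{i+2}, …, X_k)`. -/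
def hurwitzMoveFun {G : Type*} [Group G] {k : ℕ} (i : Fin (k - 1)) (x : Fin k → G) : Fin k → G :=
  fun j =>
    if j = leftPos i then x (leftPos i) * x (rightPos i) * (x (leftPos i))⁻¹
    else if j = rightPos i then x (leftPos i)
    else x j

/-- The inverse of the elementary Hurwitz move:
`(Y_1, …, Y_k) ↦ (Y_1, …, Y_{i-1}, Y_{i+1}, Y_{i+1}⁻¹ Y_i Y_{i+1}, Y_{i+2}, …, Y_k)`. -/
def hurwitzMoveInv {G : Type*} [Group G] {k : ℕ} (i : Fin (k - 1)) (y : Fin k → G) : Fin k → G :=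
  fun j =>
    if j = leftPos i then y (rightPos i)
    else if j = rightPos i then (y (rightPos i))⁻¹ * y (leftPos i) * y (rightPos i)
    else y j

theorem rightPos_ne_leftPos {k : ℕ} (i : Fin (k - 1)) : rightPos i ≠ leftPos i := by
  simp [leftPos, rightPos, Fin.ext_iff]

/-- The elementary Hurwitz move as a permutation of `G^k`. -/
def hurwitzMove (G : Type*) [Group G] {k : ℕ} (i : Fin (k - 1)) : Equiv.Perm (Fin k → G) where
  toFun := hurwitzMoveFun i
  invFun := hurwitzMoveInv i
  left_inv x := by
    have h := rightPos_ne_leftPos i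
    funext j
    by_cases h1 : j = leftPos i
    · subst h1; simp [hurwitzMoveFun, hurwitzMoveInv, h]
    · by_cases h2 : j = rightPos i
      · subst h2; simp [hurwitzMoveFun, hurwitzMoveInv, h, mul_assoc]
      · simp [hurwitzMoveFun, hurwitzMoveInv, h1, h2]
  right_inv x := by
    have h := rightPos_ne_leftPos i
    funext j
    by_cases h1 : j = leftPos i
    · subst h1; simp [hurwitzMoveFun, hurwitzMoveInv, h, mul_assoc]
    · by_cases h2 : j = rightPos i
      · subst h2; simp [hurwitzMoveFun, hurwitzMoveInv, h]
      · simp [hurwitzMoveFun, hurwitzMoveInv, h1, h2]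

theorem hurwitzMove_braid (G : Type*) [Group G] {k : ℕ} (i j : Fin (k - 1))
    (hij : (i : ℕ) + 1 = (j : ℕ)) :
    hurwitzMove G i * hurwitzMove G j * hurwitzMove G i =
      hurwitzMove G j * hurwitzMove G i * hurwitzMove G j := by
  have hm : leftPos j = rightPos i := by simp [leftPos, rightPos, hij]
  have h1 := rightPos_ne_leftPos i
  have h2 : rightPos j ≠ rightPos i := by
    simp only [rightPos, ne_eq, Fin.ext_iff]; omega
  have h3 : rightPos j ≠ leftPos i := by
    simp only [leftPos, rightPos, ne_eq, Fin.ext_iff]; omega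
  ext x m
  simp only [Equiv.Perm.mul_apply, hurwitzMove, Equiv.coe_fn_mk]
  by_cases e1 : m = leftPos i
  · subst e1
    simp [hurwitzMoveFun, hm, h1, h1.symm, h2, h3, h3.symm, mul_assoc]
  · by_cases e2 : m = rightPos i
    · subst e2
      simp [hurwitzMoveFun, hm, h1, h1.symm, h2, h2.symm, h3, h3.symm]
    · by_cases e3 : m = rightPos j
      · subst e3
        simp [hurwitzMoveFun, hm, h1, h1.symm, h2, h3, h3.symm]
      · simp [hurwitzMoveFun, hm, e1, e2, e3]

theorem hurwitzMove_comm (G : Type*) [Group G] {k : ℕ} (i j : Fin (k - 1))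
    (hij : (i : ℕ) + 1 < (j : ℕ)) :
    hurwitzMove G i * hurwitzMove G j = hurwitzMove G j * hurwitzMove G i := by
  have h1 : leftPos i ≠ leftPos j := by
    simp only [leftPos, ne_eq, Fin.ext_iff]; omega
  have h2 : leftPos i ≠ rightPos j := by
    simp only [leftPos, rightPos, ne_eq, Fin.ext_iff]; omega
  have h3 : rightPos i ≠ leftPos j := by
    simp only [leftPos, rightPos, ne_eq, Fin.ext_iff]; omega
  have h4 : rightPos i ≠ rightPos j := by
    simp only [rightPos, ne_eq, Fin.ext_iff]; omega
  ext x m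
  simp only [Equiv.Perm.mul_apply, hurwitzMove, Equiv.coe_fn_mk]
  by_cases e1 : m = leftPos i
  · subst e1; simp [hurwitzMoveFun, h1, h2, h3, h4]
  · by_cases e2 : m = rightPos i
    · subst e2
      simp [hurwitzMoveFun, h1, h2, h3, h4]
    · simp [hurwitzMoveFun, h1.symm, h2.symm, h3.symm, h4.symm, e1, e2]

/-- The Hurwitz action of the braid group `B_k` on `G^k`, given by `σ_i ↦ Σ_i`. -/
def hurwitzAction (G : Type*) [Group G] (k : ℕ) : BraidGroup k →* Equiv.Perm (Fin k → G) :=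
  PresentedGroup.toGroup (rels := braidRelators k) (f := fun i => hurwitzMove G i) (by
    rintro r (⟨i, j, hij, rfl⟩ | ⟨i, j, hij, rfl⟩)
    · simp only [map_mul, map_inv, FreeGroup.lift_apply_of]
      exact mul_inv_eq_one.2 (hurwitzMove_braid G i j hij)
    · simp only [map_mul, map_inv, FreeGroup.lift_apply_of]
      exact mul_inv_eq_one.2 (hurwitzMove_comm G i j hij))

/-- `(x_1, …, x_k)` is a quasipositive factorization of `X ∈ B₃`: the ordered product
`x_1 ⋯ x_k` equals `X`, and each `x_i` is conjugate in `B₃` to `σ₁`. -/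
def IsQuasipositiveFactorization (X : B3) {k : ℕ} (x : Fin k → B3) : Prop :=
  (List.ofFn x).prod = X ∧ ∀ i, IsConj sigma1 (x i)

/-- The orbit of a `k`-tuple under the Hurwitz action of `B_k`, as a set of tuples of arbitrary
finite length. -/
def hurwitzOrbit {G : Type*} [Group G] {k : ℕ} (x : Fin k → G) : Set (Σ m : ℕ, Fin m → G) :=
  {y | ∃ b : BraidGroup k, y = ⟨k, hurwitzAction G k b x⟩}

/-- The set of all orbits of the Hurwitz action on the quasipositive factorizations (of any
length) of `X`. -/
def quasipositiveHurwitzOrbits (X : B3) : Set (Set (Σ m : ℕ, Fin m → B3)) :=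
  {O | ∃ (k : ℕ) (x : Fin k → B3), IsQuasipositiveFactorization X x ∧ O = hurwitzOrbit x}

/-!
The map `σ₁ ↦ (1 1; 0 1)`, `σ₂ ↦ (1 0; -1 1)` is a representation `B₃ → SL(2, ℤ)`, under which a
conjugate `g σ₁ g⁻¹` acts as the transvection `u ↦ u + ω(v, u) v`, where `ω` is the area form and
`v`, the *axis*, is the first column of the matrix of `g`. A conjugate of `σ₁` is determined by its
axis (`IsAxis.eq`): by the normal form `hasNormalForm`, an element of `B₃` is, up to half twists `Δ`
on both sides, a positive word in `σ₁` and `σ₂⁻¹`, and the matrix of such a word has nonnegative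
entries, so an element whose matrix is upper triangular commutes with `σ₁`.

Since `e(X) = 2`, a quasipositive factorization of `X` is a pair `(a, b)`. Let `v₁`, `v₀` be axes of
`a`, `b` and `n = ω(v₀, v₁)`, made nonnegative by a change of sign. The matrix of `X` has trace `2 - n²`, so
all factorizations of `X` have the same `n`. The Hurwitz move replaces `(v₀, v₁)` by
`(v₁, n v₁ - v₀)`. For another factorization, with axes `w₀`, `w₁`, the numbers `s = ω(v₀, w₀)` and
`t = ω(w₀, v₁)` satisfy `s² + n s t + t² = n²` (`IsFrame.form_eq`), and its Hurwitz moves act on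
`(s, t)` by `(s, t) ↦ (t + n s, -s)`. A descent makes `s, t ≥ 0` when `n > 0`; geometrically, `w₀`
then lies between `v₀` and `v₁`. If `s = 0` or `t = 0` the two orbits coincide.

Three distinct orbits would thus give two vectors `w`, `w'` strictly between `v₀` and `v₁`, with
positive `(s, t)`, `(s', t')` and, say, `q = ω(w, w') > 0`. Put `P = s t' q`. On the one hand
`n P = (s t) (s' t') - (s t')²` and `s t, s' t' < n`, so `0 < P < n`. On the other hand, that `w` and
`w'` are integral vectors forces `n ∣ 2 P` (`dvd_two_mul_mul_mul`). Hence `n = 2 P`, which is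
impossible modulo powers of `2` (`ratio_parity`).
-/

open scoped MatrixGroups

/-! ### Solutions of `s² + n s t + t² = n²` -/

/-- Here `v₁ = a v₀ + n e`, `w = r v₀ + s e` and `w' = r' v₀ + s' e` in a basis `(v₀, e)` of `ℤ²` of
area one, so that `t = ω(w, v₁)`, `t' = ω(w', v₁)` and `q = ω(w, w')`. -/
theorem dvd_two_mul_mul_mul {n s t s' t' r r' a q : ℤ} (hn : n ≠ 0)
    (h : s ^ 2 + n * s * t + t ^ 2 = n ^ 2) (h' : s' ^ 2 + n * s' * t' + t' ^ 2 = n ^ 2)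
    (ht : t = n * r - a * s) (ht' : t' = n * r' - a * s') (hq : q = r * s' - r' * s) :
    n ∣ 2 * (s * t' * q) := by
  -- Eliminate `1 - n a + a²` from the two quadratic equations, then divide by `n`.
  have key : 2 * a * s * s' * q =
      n * (q * (s' * r + s * r') + s * s' * q + s ^ 2 - s' ^ 2) := by
    apply mul_left_cancel₀ hn
    subst ht ht' hq
    linear_combination s ^ 2 * h' - s' ^ 2 * h
  refine ⟨2 * s * q * r' - (q * (s' * r + s * r') + s * s' * q + s ^ 2 - s' ^ 2), ?_⟩
  subst ht'
  linear_combination -key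

/-- If moreover `2 s` divides `n`, then `s² ∣ t²`, and the equation can be divided by `s²`. -/
theorem exists_ratio {n s t w : ℤ} (hs : s ≠ 0) (hn : n = 2 * s * w)
    (h : s ^ 2 + n * s * t + t ^ 2 = n ^ 2) :
    ∃ τ, t = s * τ ∧ τ ^ 2 + n * τ + 1 = 4 * w ^ 2 := by
  have hd : s ^ 2 ∣ t ^ 2 := ⟨4 * w ^ 2 - 1 - 2 * w * t, by subst hn; linear_combination h⟩
  obtain ⟨τ, rfl⟩ := (Int.pow_dvd_pow_iff two_ne_zero).1 hd
  refine ⟨τ, rfl, mul_left_cancel₀ (pow_ne_zero 2 hs) ?_⟩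
  linear_combination h + (n + 2 * s * w) * hn

/-- The first equation is insoluble modulo `4` if `4 ∣ n`. If `n = 2 p` with `p` odd, the first two
give `p τ ≡ p σ ≡ 1` modulo `4`, hence `τ σ ≡ 1`, whereas `2 q² + 1 ≡ 3`. -/
theorem ratio_parity {s t' q τ σ n : ℤ} (hn : n = 2 * (s * t' * q))
    (h1 : τ ^ 2 + n * τ + 1 = 4 * (t' * q) ^ 2) (h2 : σ ^ 2 + n * σ + 1 = 4 * (s * q) ^ 2)
    (h3 : τ * σ = 2 * q ^ 2 + 1) : False := by
  rcases Int.even_or_odd (s * t' * q) with he | ho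
  · obtain ⟨u, hu⟩ := he
    have h4 : τ ^ 2 + 1 = 4 * ((t' * q) ^ 2 - u * τ) := by
      have : n = 4 * u := by omega
      subst this; linear_combination h1
    rcases Int.even_or_odd' τ with ⟨v, rfl | rfl⟩ <;> ring_nf at h4 <;> omega
  · obtain ⟨⟨os, ot⟩, oq⟩ : (Odd s ∧ Odd t') ∧ Odd q := by simpa [Int.odd_mul] using ho
    have hτσ : Odd (τ * σ) := h3 ▸ ⟨q ^ 2, rfl⟩
    obtain ⟨oτ, oσ⟩ := Int.odd_mul.1 hτσ
    have sq : ∀ a : ℤ, Odd a → a ^ 2 % 8 = 1 := fun a ha => by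
      have := Int.eight_dvd_sq_sub_one_of_odd ha
      omega
    set p := s * t' * q
    have e1 := sq τ oτ
    have e2 := sq σ oσ
    have e3 := sq _ (ot.mul oq)
    have e4 := sq _ (os.mul oq)
    have e5 := sq q oq
    have e6 := sq p ho
    subst hn
    obtain ⟨i, hi⟩ : ∃ i, p * τ = 4 * i + 1 := ⟨(p * τ) / 4, by
      have : τ ^ 2 + 2 * (p * τ) + 1 = 4 * (t' * q) ^ 2 := by linear_combination h1
      omega⟩
    obtain ⟨j, hj⟩ : ∃ j, p * σ = 4 * j + 1 := ⟨(p * σ) / 4, by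
      have : σ ^ 2 + 2 * (p * σ) + 1 = 4 * (s * q) ^ 2 := by linear_combination h2
      omega⟩
    obtain ⟨k, hk⟩ : ∃ k, p ^ 2 = 8 * k + 1 := ⟨p ^ 2 / 8, by omega⟩
    have : (8 * k + 1) * (2 * q ^ 2 + 1) = (4 * i + 1) * (4 * j + 1) := by
      rw [← hk, ← h3, ← hi, ← hj]; ring
    obtain ⟨l, hl⟩ : ∃ l, q ^ 2 = 8 * l + 1 := ⟨q ^ 2 / 8, by omega⟩
    rw [hl] at this
    ring_nf at this
    omega

theorem mul_lt_of_form_eq {n s t : ℤ} (hn : 0 < n) (hs : 0 < s)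
    (h : s ^ 2 + n * s * t + t ^ 2 = n ^ 2) : s * t < n := by
  by_contra! hc
  nlinarith [mul_le_mul_of_nonneg_left hc hn.le, sq_nonneg t, pow_pos hs 2]

/-- There are no two distinct axes strictly between `v₀` and `v₁`; the notation is that of
`dvd_two_mul_mul_mul`. -/
theorem no_two_interlaced {n s t s' t' r r' a q : ℤ} (hn : 0 < n)
    (hs : 0 < s) (ht0 : 0 < t) (hs' : 0 < s') (ht0' : 0 < t') (hq0 : 0 < q)
    (h : s ^ 2 + n * s * t + t ^ 2 = n ^ 2) (h' : s' ^ 2 + n * s' * t' + t' ^ 2 = n ^ 2)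
    (ht : t = n * r - a * s) (ht' : t' = n * r' - a * s') (hq : q = r * s' - r' * s) :
    False := by
  have hd := dvd_two_mul_mul_mul hn.ne' h h' ht ht' hq
  have hnq : n * q = t * s' - s * t' := by subst ht ht' hq; ring
  have hP : 0 < s * t' * q := by positivity
  have hlt : s * t' * q < n := by
    have h1 := mul_lt_of_form_eq hn hs h
    have h2 := mul_lt_of_form_eq hn hs' h'
    have h3 : (s * t) * (s' * t') < n * n :=
      mul_lt_mul'' h1 h2 (by positivity) (by positivity)
    have h4 : n * (s * t' * q) = (s * t) * (s' * t') - (s * t') ^ 2 := by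
      linear_combination s * t' * hnq
    have : n * (s * t' * q) < n * n := by nlinarith [sq_nonneg (s * t')]
    exact lt_of_mul_lt_mul_left this hn.le
  have hn2 : n = 2 * (s * t' * q) := by
    obtain ⟨c, hc⟩ := hd
    have c1 : 0 < c := by
      by_contra! h0
      nlinarith [mul_nonneg hn.le (neg_nonneg.2 h0)]
    have c2 : c < 2 := by
      by_contra! h0
      nlinarith [mul_le_mul_of_nonneg_left h0 hn.le]
    obtain rfl : c = 1 := by omega
    linarith
  obtain ⟨τ, rfl, e1⟩ := exists_ratio (w := t' * q) hs.ne' (by rw [hn2]; ring) h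
  obtain ⟨σ, rfl, e2⟩ := exists_ratio (n := n) (s := t') (t := s') (w := s * q) ht0'.ne'
    (by rw [hn2]; ring) (by linear_combination h')
  refine ratio_parity hn2 e1 e2 (mul_left_cancel₀ (mul_pos hs ht0').ne' ?_)
  linear_combination -hnq + q * hn2

/-- The descent step: replacing `(s, t)` by `(-t, s + n t)` either makes the signs agree or shrinks
the larger entry. -/
theorem natAbs_add_mul_lt {n s t : ℤ} (hn : 0 < n)
    (h : s ^ 2 + n * s * t + t ^ 2 = n ^ 2) (hst : s * t < 0) (hle : t.natAbs ≤ s.natAbs) :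
    0 ≤ -t * (s + n * t) ∨ (s + n * t).natAbs < s.natAbs := by
  have h1 : (s + n * t) * s = n ^ 2 - t ^ 2 := by linear_combination h
  have h2 := Int.natAbs_le_iff_sq_le.1 hle
  have h3 := pow_pos hn 2
  generalize s + n * t = a at *
  rw [or_iff_not_imp_left, not_le]
  intro h0
  rcases lt_or_gt_of_ne (left_ne_zero_of_mul hst.ne) with hs | hs
  · have ht : 0 < t := by nlinarith
    have ha : 0 < a := by nlinarith
    have : a < -s := by nlinarith
    omega
  · have ht : t < 0 := by nlinarith
    have ha : a < 0 := by nlinarith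
    have : -a < s := by nlinarith
    omega

/-! ### A normal form in `B₃` -/

/-- The standard generator `σ₂` of `B₃`. -/
def sigma2 : B3 := PresentedGroup.of (1 : Fin 2)

theorem sigma1_mul_sigma2_mul_sigma1 :
    sigma1 * sigma2 * sigma1 = sigma2 * sigma1 * sigma2 := by
  have := PresentedGroup.one_of_mem (rels := braidRelators 3)
    (Or.inl ⟨(0 : Fin 2), (1 : Fin 2), rfl, rfl⟩)
  rw [map_mul, map_inv] at this
  exact mul_inv_eq_one.1 this

/-- The half twist `Δ = σ₁σ₂σ₁`, whose square is central. -/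
def halfTwist : B3 := sigma1 * sigma2 * sigma1

theorem halfTwist_mul_sigma1 : halfTwist * sigma1 = sigma2 * halfTwist := by
  rw [halfTwist]
  nth_rewrite 1 [sigma1_mul_sigma2_mul_sigma1]
  simp only [mul_assoc]

theorem halfTwist_mul_sigma2 : halfTwist * sigma2 = sigma1 * halfTwist := by
  rw [halfTwist]
  nth_rewrite 2 [sigma1_mul_sigma2_mul_sigma1]
  simp only [mul_assoc]

theorem B3.induction {P : B3 → Prop} (h1 : P sigma1) (h2 : P sigma2) (h1' : P sigma1⁻¹)
    (h2' : P sigma2⁻¹) (one : P 1) (mul : ∀ g h, P g → P h → P (g * h)) (g : B3) : P g := by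
  induction g using PresentedGroup.induction_on with
  | _ w =>
    induction w using FreeGroup.induction_on with
    | C1 => simpa using one
    | of i =>
      match i with
      | (0 : Fin 2) => exact h1
      | (1 : Fin 2) => exact h2
    | inv_of i _ =>
      rw [map_inv]
      match i with
      | (0 : Fin 2) => exact h1'
      | (1 : Fin 2) => exact h2'
    | mul x y hx hy => rw [map_mul]; exact mul _ _ hx hy

theorem commute_halfTwist_sq (g : B3) : Commute (halfTwist ^ 2) g := by
  have h1 : Commute (halfTwist ^ 2) sigma1 := by
    rw [Commute, SemiconjBy, sq, mul_assoc, halfTwist_mul_sigma1, ← mul_assoc,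
      halfTwist_mul_sigma2, mul_assoc]
  have h2 : Commute (halfTwist ^ 2) sigma2 := by
    rw [Commute, SemiconjBy, sq, mul_assoc, halfTwist_mul_sigma2, ← mul_assoc,
      halfTwist_mul_sigma1, mul_assoc]
  induction g using B3.induction with
  | h1 => exact h1
  | h2 => exact h2
  | h1' => exact h1.inv_right
  | h2' => exact h2.inv_right
  | one => exact Commute.one_right _
  | mul g h hg hh => exact hg.mul_right hh

/-- The submonoid of `B₃` generated by `σ₁` and `σ₂⁻¹`, whose elements act on `ℤ²` by matrices with
nonnegative entries. -/
def upperMonoid : Submonoid B3 := Submonoid.closure {sigma1, sigma2⁻¹}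

/-- `g` is of the form `Δ^i m` or `Δ^i m Δ` with `m` a positive word in `σ₁` and `σ₂⁻¹`. -/
def HasNormalForm (g : B3) : Prop :=
  ∃ (i : ℤ), ∃ m ∈ upperMonoid, g = halfTwist ^ i * m ∨ g = halfTwist ^ i * m * halfTwist

theorem sigma1_mem_upperMonoid : sigma1 ∈ upperMonoid := Submonoid.subset_closure (by simp)

theorem sigma2_inv_mem_upperMonoid : sigma2⁻¹ ∈ upperMonoid := Submonoid.subset_closure (by simp)

theorem upperMonoid_cases_right {m : B3} (hm : m ∈ upperMonoid) :
    m = 1 ∨ ∃ m' ∈ upperMonoid, m = m' * sigma1 ∨ m = m' * sigma2⁻¹ := by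
  induction hm using Submonoid.closure_induction_right with
  | one => exact Or.inl rfl
  | mul_right x hx y hy _ =>
    rcases hy with rfl | rfl
    · exact Or.inr ⟨x, hx, Or.inl rfl⟩
    · exact Or.inr ⟨x, hx, Or.inr rfl⟩

-- These four relations remove a half twist from the interior of a word in `σ₁`, `σ₂⁻¹` and `Δ`.
theorem sigma1_halfTwist_sigma1 : sigma1 * halfTwist * sigma1 = halfTwist ^ 2 * sigma2⁻¹ := by
  rw [(commute_halfTwist_sq _).eq, eq_inv_mul_iff_mul_eq, mul_assoc sigma1, halfTwist_mul_sigma1,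
    sq, ← mul_assoc, ← mul_assoc, ← sigma1_mul_sigma2_mul_sigma1, ← halfTwist]

theorem sigma1_halfTwist_sigma2_inv : sigma1 * halfTwist * sigma2⁻¹ = halfTwist := by
  rw [mul_inv_eq_iff_eq_mul, halfTwist_mul_sigma2]

theorem sigma2_inv_halfTwist_sigma1 : sigma2⁻¹ * halfTwist * sigma1 = halfTwist := by
  rw [mul_assoc, halfTwist_mul_sigma1, inv_mul_cancel_left]

theorem sigma2_inv_halfTwist_sigma2_inv : sigma2⁻¹ * halfTwist * sigma2⁻¹ = sigma1 := by
  rw [mul_inv_eq_iff_eq_mul, inv_mul_eq_iff_eq_mul, ← mul_assoc, halfTwist,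
    sigma1_mul_sigma2_mul_sigma1]

theorem HasNormalForm.mul_sq {g : B3} (h : HasNormalForm g) (k : ℤ) :
    HasNormalForm (g * (halfTwist ^ 2) ^ k) := by
  obtain ⟨i, m, hm, h⟩ := h
  refine ⟨2 * k + i, m, hm, h.imp ?_ ?_⟩ <;> rintro rfl <;>
    rw [← ((commute_halfTwist_sq _).zpow_left k).eq, zpow_add, zpow_mul] <;>
    simp only [mul_assoc] <;> rfl

theorem HasNormalForm.mul_halfTwist {g : B3} (h : HasNormalForm g) :
    HasNormalForm (g * halfTwist) := by
  obtain ⟨i, m, hm, rfl | rfl⟩ := h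
  · exact ⟨i, m, hm, Or.inr rfl⟩
  · have := HasNormalForm.mul_sq ⟨i, m, hm, Or.inl rfl⟩ 1
    simpa [sq, mul_assoc] using this

theorem HasNormalForm.mul_sigma1 {g : B3} (h : HasNormalForm g) :
    HasNormalForm (g * sigma1) := by
  obtain ⟨i, m, hm, rfl | rfl⟩ := h
  · exact ⟨i, m * sigma1, mul_mem hm sigma1_mem_upperMonoid, Or.inl (mul_assoc _ _ _)⟩
  · rcases upperMonoid_cases_right hm with rfl | ⟨m', hm', rfl | rfl⟩
    · refine ⟨i + 1, sigma1, sigma1_mem_upperMonoid, Or.inl ?_⟩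
      rw [zpow_add_one, mul_one]
    · have := HasNormalForm.mul_sq
        ⟨i, m' * sigma2⁻¹, mul_mem hm' sigma2_inv_mem_upperMonoid, Or.inl rfl⟩ 1
      rw [zpow_one] at this
      convert this using 1
      have := sigma1_halfTwist_sigma1
      rw [(commute_halfTwist_sq _).eq] at this
      simp only [mul_assoc] at this ⊢
      rw [this]
    · refine ⟨i, m', hm', Or.inr ?_⟩
      have := sigma2_inv_halfTwist_sigma1
      simp only [mul_assoc] at this ⊢
      rw [this]

theorem HasNormalForm.mul_sigma2_inv {g : B3} (h : HasNormalForm g) :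
    HasNormalForm (g * sigma2⁻¹) := by
  obtain ⟨i, m, hm, rfl | rfl⟩ := h
  · exact ⟨i, m * sigma2⁻¹, mul_mem hm sigma2_inv_mem_upperMonoid, Or.inl (mul_assoc _ _ _)⟩
  · rcases upperMonoid_cases_right hm with rfl | ⟨m', hm', rfl | rfl⟩
    · refine ⟨i + 1, sigma2⁻¹, sigma2_inv_mem_upperMonoid, Or.inl ?_⟩
      rw [zpow_add_one, mul_one]
    · refine ⟨i, m', hm', Or.inr ?_⟩
      have := sigma1_halfTwist_sigma2_inv
      simp only [mul_assoc] at this ⊢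
      rw [this]
    · refine ⟨i, m' * sigma1, mul_mem hm' sigma1_mem_upperMonoid, Or.inl ?_⟩
      have := sigma2_inv_halfTwist_sigma2_inv
      simp only [mul_assoc] at this ⊢
      rw [this]

theorem hasNormalForm (g : B3) : HasNormalForm g := by
  suffices ∀ h, HasNormalForm h → HasNormalForm (h * g) by
    simpa using this 1 ⟨0, 1, one_mem _, Or.inl (by simp)⟩
  have e : halfTwist⁻¹ = halfTwist * (halfTwist ^ 2) ^ (-1 : ℤ) := by
    rw [zpow_neg_one, sq]; group
  induction g using B3.induction with
  | h1 => exact fun h => HasNormalForm.mul_sigma1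
  | h2' => exact fun h => HasNormalForm.mul_sigma2_inv
  | h2 =>
    intro h hh
    have := (hh.mul_halfTwist.mul_sigma1.mul_halfTwist).mul_sq (-1)
    rwa [mul_assoc _ halfTwist, ← e, mul_assoc h, halfTwist_mul_sigma1, mul_assoc h,
      mul_inv_cancel_right] at this
  | h1' =>
    intro h hh
    have := (hh.mul_halfTwist.mul_sigma2_inv.mul_halfTwist).mul_sq (-1)
    have e' : halfTwist * sigma2⁻¹ = sigma1⁻¹ * halfTwist := by
      rw [mul_inv_eq_iff_eq_mul, mul_assoc, halfTwist_mul_sigma2, inv_mul_cancel_left]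
    rwa [mul_assoc _ halfTwist, ← e, mul_assoc h, e', mul_assoc h,
      mul_inv_cancel_right] at this
  | one => intro h hh; rwa [mul_one]
  | mul g k hg hk => intro h hh; rw [← mul_assoc]; exact hk _ (hg _ hh)


/-! ### The representation in `SL(2, ℤ)` -/

/-- The matrices of `σ₁` and `σ₂` under `slTwoRep`. -/
def slTwoGen : Fin 2 → SL(2, ℤ) := ![⟨!![1, 1; 0, 1], by simp⟩, ⟨!![1, 0; -1, 1], by simp⟩]

theorem slTwoGen_braid :
    slTwoGen 0 * slTwoGen 1 * slTwoGen 0 = slTwoGen 1 * slTwoGen 0 * slTwoGen 1 := by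
  ext i j
  fin_cases i <;> fin_cases j <;> rfl

/-- The representation `B₃ → SL(2, ℤ)`, which is the reduced Burau representation at `t = -1` up to
conjugation. -/
def slTwoRep : B3 →* SL(2, ℤ) :=
  PresentedGroup.toGroup (rels := braidRelators 3) (f := slTwoGen) (by
    rintro r (⟨i, j, hij, rfl⟩ | ⟨i, j, hij, rfl⟩)
    · obtain ⟨rfl, rfl⟩ : i = (0 : Fin 2) ∧ j = (1 : Fin 2) := by
        constructor <;> ext <;> simp <;> omega
      simp only [map_mul, map_inv, FreeGroup.lift_apply_of]
      exact mul_inv_eq_one.2 slTwoGen_braid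
    · omega)

theorem slTwoRep_sigma1 : (slTwoRep sigma1 : Matrix (Fin 2) (Fin 2) ℤ) = !![1, 1; 0, 1] := by
  simp [slTwoRep, slTwoGen, sigma1]

theorem slTwoRep_sigma2 : (slTwoRep sigma2 : Matrix (Fin 2) (Fin 2) ℤ) = !![1, 0; -1, 1] := by
  simp [slTwoRep, slTwoGen, sigma2]

theorem slTwoRep_sigma2_inv :
    (slTwoRep sigma2⁻¹ : Matrix (Fin 2) (Fin 2) ℤ) = !![1, 0; 1, 1] := by
  simp [slTwoRep_sigma2, Matrix.adjugate_fin_two]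

theorem slTwoRep_halfTwist :
    (slTwoRep halfTwist : Matrix (Fin 2) (Fin 2) ℤ) = !![0, 1; -1, 0] := by
  simp [halfTwist, slTwoRep_sigma1, slTwoRep_sigma2]

theorem slTwoRep_mul_apply (g h : B3) (i j : Fin 2) :
    slTwoRep (g * h) i j = slTwoRep g i 0 * slTwoRep h 0 j + slTwoRep g i 1 * slTwoRep h 1 j := by
  simp [Matrix.mul_apply]

/-- The second entry of the first column vanishes only for powers of `σ₁`, as a factor `σ₂⁻¹` makes it
positive for good. -/
theorem col_zero_of_mem {m : B3} (hm : m ∈ upperMonoid) :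
    1 ≤ slTwoRep m 0 0 ∧ 0 ≤ slTwoRep m 1 0 ∧ (slTwoRep m 1 0 = 0 → Commute m sigma1) := by
  induction hm using Submonoid.closure_induction_left with
  | one => simp
  | mul_left x hx y hy ih =>
    obtain ⟨h1, h2, h3⟩ := ih
    rcases hx with rfl | rfl <;>
      simp only [slTwoRep_mul_apply, slTwoRep_sigma1, slTwoRep_sigma2_inv]
    · refine ⟨by simp; omega, by simpa using h2, fun h => ?_⟩
      exact (Commute.refl _).mul_left (h3 (by simpa using h))
    · exact ⟨by simpa using h1, by simp; omega, fun h => by simp at h; omega⟩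

theorem col_one_of_mem {m : B3} (hm : m ∈ upperMonoid) :
    1 ≤ slTwoRep m 1 1 ∧ 0 ≤ slTwoRep m 0 1 ∧ (slTwoRep m 0 1 = 0 → Commute m sigma2) := by
  induction hm using Submonoid.closure_induction_left with
  | one => simp
  | mul_left x hx y hy ih =>
    obtain ⟨h1, h2, h3⟩ := ih
    rcases hx with rfl | rfl <;>
      simp only [slTwoRep_mul_apply, slTwoRep_sigma1, slTwoRep_sigma2_inv]
    · exact ⟨by simpa using h1, by simp; omega, fun h => by simp at h; omega⟩
    · refine ⟨by simp; omega, by simpa using h2, fun h => ?_⟩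
      exact ((Commute.refl _).inv_left).mul_left (h3 (by simpa using h))

theorem slTwoRep_halfTwist_sq_mul (g : B3) (i j : Fin 2) :
    slTwoRep (halfTwist ^ 2 * g) i j = -slTwoRep g i j := by
  rw [sq, mul_assoc]
  fin_cases i <;> simp only [slTwoRep_mul_apply, slTwoRep_halfTwist] <;> simp

theorem slTwoRep_halfTwist_sq_zpow_mul (k : ℤ) (g : B3) (i j : Fin 2) :
    slTwoRep ((halfTwist ^ 2) ^ k * g) i j = 0 ↔ slTwoRep g i j = 0 := by
  induction k using Int.induction_on generalizing g with
  | zero => simp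
  | succ k ih => rw [zpow_add_one, mul_assoc, ih, slTwoRep_halfTwist_sq_mul, neg_eq_zero]
  | pred k ih =>
    rw [zpow_sub_one, mul_assoc, ih, ← neg_eq_zero, ← slTwoRep_halfTwist_sq_mul,
      mul_inv_cancel_left]

/-- An element of `B₃` that fixes the first basis vector of `ℤ²` up to sign commutes with `σ₁`. -/
theorem commute_sigma1_of_apply_eq_zero {g : B3} (hg : slTwoRep g 1 0 = 0) : Commute g sigma1 := by
  obtain ⟨i, m, hm, h⟩ := hasNormalForm g
  obtain ⟨c1, c2, c3⟩ := col_zero_of_mem hm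
  obtain ⟨d1, d2, d3⟩ := col_one_of_mem hm
  obtain ⟨k, rfl | rfl⟩ := Int.even_or_odd' i
  all_goals
    simp only [zpow_add_one, zpow_mul, mul_assoc] at h
    rcases h with rfl | rfl
    all_goals
      replace hg := (slTwoRep_halfTwist_sq_zpow_mul _ _ _ _).1 hg
      refine ((commute_halfTwist_sq _).zpow_left k).mul_left ?_
  -- In the four cases `g` is, up to a central factor, `m`, `m Δ`, `Δ m` or `Δ m Δ`.
  · exact c3 hg
  all_goals simp only [slTwoRep_mul_apply, slTwoRep_halfTwist] at hg
  · simp at hg; omega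
  · simp at hg; omega
  · have := d3 (by simpa using hg)
    rw [Commute, SemiconjBy, mul_assoc, mul_assoc, halfTwist_mul_sigma1, ← mul_assoc m, this.eq,
      mul_assoc, ← mul_assoc, halfTwist_mul_sigma2]
    simp only [mul_assoc]

/-! ### Conjugates of `σ₁` and their axes -/

/-- The area form on `ℤ²`. -/
def area (v w : Fin 2 → ℤ) : ℤ := v 0 * w 1 - v 1 * w 0

/-- `v` is an axis of `a`: `a = g σ₁ g⁻¹` for some `g` whose matrix has first column `v`. By
`IsAxis.neg` and `IsAxis.exists_area_eq_one` axes are primitive vectors, and matter only up to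
sign. -/
def IsAxis (a : B3) (v : Fin 2 → ℤ) : Prop :=
  ∃ g : B3, a = g * sigma1 * g⁻¹ ∧ v = fun i => slTwoRep g i 0

theorem IsAxis.neg {a : B3} {v : Fin 2 → ℤ} (h : IsAxis a v) : IsAxis a (-v) := by
  obtain ⟨g, rfl, rfl⟩ := h
  refine ⟨halfTwist ^ 2 * g, ?_, ?_⟩
  · have := (commute_halfTwist_sq (g * sigma1 * g⁻¹)).eq
    rw [eq_comm]
    calc _ = halfTwist ^ 2 * (g * sigma1 * g⁻¹) * (halfTwist ^ 2)⁻¹ := by group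
      _ = _ := by rw [this, mul_inv_cancel_right]
  · ext i; simp only [Pi.neg_apply, slTwoRep_halfTwist_sq_mul]

theorem slTwoRep_det (g : B3) :
    slTwoRep g 0 0 * slTwoRep g 1 1 - slTwoRep g 0 1 * slTwoRep g 1 0 = 1 := by
  rw [← Matrix.det_fin_two]; exact (slTwoRep g).2

theorem IsAxis.exists_area_eq_one {a : B3} {v : Fin 2 → ℤ} (h : IsAxis a v) :
    ∃ e, area v e = 1 := by
  obtain ⟨g, rfl, rfl⟩ := h
  exact ⟨fun i => slTwoRep g i 1, by simp only [area]; linarith [slTwoRep_det g]⟩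

theorem slTwoRep_inv (g : B3) : (slTwoRep g⁻¹ : Matrix (Fin 2) (Fin 2) ℤ) =
    !![slTwoRep g 1 1, -slTwoRep g 0 1; -slTwoRep g 1 0, slTwoRep g 0 0] := by
  simp [Matrix.adjugate_fin_two]

theorem IsAxis.eq {a b : B3} {v : Fin 2 → ℤ} (ha : IsAxis a v) (hb : IsAxis b v) : a = b := by
  obtain ⟨g, rfl, rfl⟩ := ha
  obtain ⟨h, rfl, e⟩ := hb
  have e0 : slTwoRep g 0 0 = slTwoRep h 0 0 := congrFun e 0
  have e1 : slTwoRep g 1 0 = slTwoRep h 1 0 := congrFun e 1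
  have : Commute (h⁻¹ * g) sigma1 := by
    apply commute_sigma1_of_apply_eq_zero
    rw [slTwoRep_mul_apply, slTwoRep_inv, e0, e1]
    simp; ring
  have := this.eq
  rw [← mul_inv_eq_iff_eq_mul] at this
  calc _ = h * (h⁻¹ * g * sigma1 * (h⁻¹ * g)⁻¹) * h⁻¹ := by group
    _ = _ := by rw [this]

/-- If `v` is an axis of `a`, then `a` acts on `ℤ²` as the transvection `u ↦ u + ω(v, u) v`, here applied
to the columns of a matrix. -/
theorem IsAxis.slTwoRep_mul {a : B3} {v : Fin 2 → ℤ} (h : IsAxis a v) (g : B3) (i j : Fin 2) :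
    slTwoRep (a * g) i j = slTwoRep g i j + area v (fun k => slTwoRep g k j) * v i := by
  obtain ⟨k, rfl, rfl⟩ := h
  have := slTwoRep_det k
  fin_cases i <;>
    simp only [slTwoRep_mul_apply, slTwoRep_inv, slTwoRep_sigma1, area] <;> simp
  · linear_combination slTwoRep g 0 j * this
  · linear_combination slTwoRep g 1 j * this

theorem IsAxis.conj {a b : B3} {v w : Fin 2 → ℤ} (ha : IsAxis a v) (hb : IsAxis b w) :
    IsAxis (a * b * a⁻¹) (w + area v w • v) := by
  obtain ⟨g, rfl, rfl⟩ := hb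
  refine ⟨a * g, by group, ?_⟩
  ext i
  simp only [ha.slTwoRep_mul]
  simp

theorem IsAxis.conj_inv {a b : B3} {v w : Fin 2 → ℤ} (ha : IsAxis a v) (hb : IsAxis b w) :
    IsAxis (a⁻¹ * b * a) (w - area v w • v) := by
  obtain ⟨g, rfl, rfl⟩ := hb
  refine ⟨a⁻¹ * g, by group, ?_⟩
  have key := fun i j => ha.slTwoRep_mul (a⁻¹ * g) i j
  simp only [mul_inv_cancel_left] at key
  ext i
  simp only [key _ 0, Pi.sub_apply, Pi.smul_apply, smul_eq_mul, area]
  ring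

theorem eq_or_eq_neg_of_area_eq_zero {v w : Fin 2 → ℤ} (hv : ∃ e, area v e = 1)
    (hw : ∃ e, area w e = 1) (h : area v w = 0) : v = w ∨ v = -w := by
  obtain ⟨e, he⟩ := hv
  obtain ⟨f, hf⟩ := hw
  have h1 : w = area w e • v := by
    ext i; fin_cases i <;> simp [area] at *
    · linear_combination -w 0 * he + e 0 * h
    · linear_combination -w 1 * he + e 1 * h
  have h2 : area w e * area v f = 1 := by
    rw [← hf]; nth_rewrite 2 [h1]; simp [area]; ring
  rcases Int.isUnit_iff.1 (IsUnit.of_mul_eq_one _ h2) with h3 | h3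
  · left; rw [h1, h3, one_smul]
  · right; rw [h1, h3]; simp

theorem IsAxis.eq_of_area_eq_zero {a b : B3} {v w : Fin 2 → ℤ} (ha : IsAxis a v)
    (hb : IsAxis b w) (h : area v w = 0) : a = b := by
  rcases eq_or_eq_neg_of_area_eq_zero ha.exists_area_eq_one hb.exists_area_eq_one h with rfl | rfl
  · exact ha.eq hb
  · exact ha.eq hb.neg

/-! ### Pairs of axes and Hurwitz moves -/

/-- `x` is a factorization of `X` into two conjugates of `σ₁` with axes `v₁`, `v₀`, where the
area of `(v₀, v₁)` is `n`. The axis of the *second* factor comes first: with this order the Hurwitz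
move is `(v₀, v₁) ↦ (v₁, n v₁ - v₀)`, without extra signs. -/
structure IsFrame (X : B3) (n : ℤ) (x : Fin 2 → B3) (v₀ v₁ : Fin 2 → ℤ) : Prop where
  prod_eq : x 0 * x 1 = X
  axis_fst : IsAxis (x 0) v₁
  axis_snd : IsAxis (x 1) v₀
  area_eq : area v₀ v₁ = n

theorem hurwitzOrbit_hurwitzMove {G : Type*} [Group G] {k : ℕ} (i : Fin (k - 1)) (x : Fin k → G) :
    hurwitzOrbit (hurwitzMove G i x) = hurwitzOrbit x := by
  have h : hurwitzMove G i = hurwitzAction G k (PresentedGroup.of i) := by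
    simp [hurwitzAction]
  ext y
  constructor
  · rintro ⟨b, rfl⟩
    exact ⟨b * PresentedGroup.of i, by rw [map_mul, h]; rfl⟩
  · rintro ⟨b, rfl⟩
    refine ⟨b * (PresentedGroup.of i)⁻¹, ?_⟩
    rw [map_mul, map_inv, h, ← Equiv.Perm.mul_apply, inv_mul_cancel_right]

namespace IsFrame
variable {X : B3} {n m : ℤ} {x y z : Fin 2 → B3} {v₀ v₁ w₀ w₁ u₀ u₁ : Fin 2 → ℤ}

theorem neg (h : IsFrame X n x v₀ v₁) : IsFrame X n x (-v₀) (-v₁) :=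
  ⟨h.prod_eq, h.axis_fst.neg, h.axis_snd.neg, by simp [← h.area_eq, area]⟩

theorem next (h : IsFrame X n x v₀ v₁) :
    ∃ y, hurwitzOrbit y = hurwitzOrbit x ∧ IsFrame X n y v₁ (n • v₁ - v₀) := by
  refine ⟨_, hurwitzOrbit_hurwitzMove (0 : Fin 1) x, ?_⟩
  have e0 : hurwitzMove B3 (k := 2) (0 : Fin 1) x 0 = x 0 * x 1 * (x 0)⁻¹ := rfl
  have e1 : hurwitzMove B3 (k := 2) (0 : Fin 1) x 1 = x 0 := rfl
  refine ⟨by rw [e0, e1, inv_mul_cancel_right, h.prod_eq], ?_, e1 ▸ h.axis_fst, ?_⟩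
  · rw [e0]
    convert (h.axis_fst.conj h.axis_snd).neg using 1
    rw [← h.area_eq]
    ext i; simp [area]; ring
  · rw [← h.area_eq]; simp [area]; ring

theorem prev (h : IsFrame X n x v₀ v₁) :
    ∃ y, hurwitzOrbit y = hurwitzOrbit x ∧ IsFrame X n y (n • v₀ - v₁) v₀ := by
  refine ⟨(hurwitzMove B3 (k := 2) (0 : Fin 1)).symm x, ?_, ?_⟩
  · rw [← hurwitzOrbit_hurwitzMove (0 : Fin 1), Equiv.apply_symm_apply]
  have e0 : (hurwitzMove B3 (k := 2) (0 : Fin 1)).symm x 0 = x 1 := rfl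
  have e1 : (hurwitzMove B3 (k := 2) (0 : Fin 1)).symm x 1 = (x 1)⁻¹ * x 0 * x 1 := rfl
  refine ⟨by rw [e0, e1, ← h.prod_eq]; group, e0 ▸ h.axis_snd, ?_, ?_⟩
  · rw [e1]
    convert (h.axis_snd.conj_inv h.axis_fst).neg using 1
    rw [← h.area_eq]
    ext i; simp
  · rw [← h.area_eq]; simp [area]; ring

/-- The matrix form of `slTwoRep_mulVec`. -/
theorem slTwoRep_apply (h : IsFrame X n x v₀ v₁) (i j : Fin 2) :
    slTwoRep X i j = (1 : Matrix (Fin 2) (Fin 2) ℤ) i j +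
      area v₀ (fun k => (1 : Matrix (Fin 2) (Fin 2) ℤ) k j) * v₀ i +
      (area v₁ (fun k => (1 : Matrix (Fin 2) (Fin 2) ℤ) k j) -
      n * area v₀ (fun k => (1 : Matrix (Fin 2) (Fin 2) ℤ) k j)) * v₁ i := by
  have e : ∀ i j, slTwoRep (x 1) i j = (1 : Matrix (Fin 2) (Fin 2) ℤ) i j +
      area v₀ (fun k => (1 : Matrix (Fin 2) (Fin 2) ℤ) k j) * v₀ i := by
    intro i j
    have := h.axis_snd.slTwoRep_mul 1 i j
    simpa using this
  rw [← h.prod_eq, h.axis_fst.slTwoRep_mul, ← h.area_eq]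
  simp only [e, area]
  ring

theorem slTwoRep_mulVec (h : IsFrame X n x v₀ v₁) (u : Fin 2 → ℤ) (i : Fin 2) :
    slTwoRep X i 0 * u 0 + slTwoRep X i 1 * u 1 =
      u i + area v₀ u * v₀ i + (area v₁ u - n * area v₀ u) * v₁ i := by
  rw [h.slTwoRep_apply, h.slTwoRep_apply]
  obtain rfl | rfl : i = 0 ∨ i = 1 := by omega
  all_goals simp [area]; ring

theorem trace_eq (h : IsFrame X n x v₀ v₁) : slTwoRep X 0 0 + slTwoRep X 1 1 = 2 - n ^ 2 := by
  rw [h.slTwoRep_apply, h.slTwoRep_apply, ← h.area_eq]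
  simp [area]; ring

/-- The action of `X` on `w₀`, computed in both frames, expresses `w₁` through `v₀` and `v₁`. -/
theorem smul_snd_eq (h : IsFrame X n x v₀ v₁) (k : IsFrame X n y w₀ w₁) (i : Fin 2) :
    n * w₁ i = -area v₀ w₀ * v₀ i + (area w₀ v₁ + n * area v₀ w₀) * v₁ i := by
  have e1 := h.slTwoRep_mulVec w₀ i
  have e2 := k.slTwoRep_mulVec w₀ i
  have a0 : area w₀ w₀ = 0 := by simp [area]; ring
  have a1 : area w₁ w₀ = -n := by rw [← k.area_eq, area, area]; ring
  have a2 : area v₁ w₀ = -area w₀ v₁ := by rw [area, area]; ring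
  rw [a0, a1] at e2
  rw [a2] at e1
  linear_combination e2 - e1

theorem form_eq (h : IsFrame X n x v₀ v₁) (k : IsFrame X n y w₀ w₁) :
    area v₀ w₀ ^ 2 + n * area v₀ w₀ * area w₀ v₁ + area w₀ v₁ ^ 2 = n ^ 2 := by
  have e0 := h.smul_snd_eq k 0
  have e1 := h.smul_snd_eq k 1
  have e := k.area_eq
  simp only [area] at *
  linear_combination n * e - w₀ 0 * e1 + w₀ 1 * e0

theorem area_fst_snd (hn : n ≠ 0) (h : IsFrame X n x v₀ v₁) (k : IsFrame X n y w₀ w₁) :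
    area v₀ w₁ = area w₀ v₁ + n * area v₀ w₀ := by
  apply mul_left_cancel₀ hn
  have e0 := h.smul_snd_eq k 0
  have e1 := h.smul_snd_eq k 1
  have e := h.area_eq
  simp only [area] at *
  linear_combination v₀ 0 * e1 - v₀ 1 * e0 +
    (w₀ 0 * v₁ 1 - w₀ 1 * v₁ 0 + n * (v₀ 0 * w₀ 1 - v₀ 1 * w₀ 0)) * e

theorem area_snd_snd (hn : n ≠ 0) (h : IsFrame X n x v₀ v₁) (k : IsFrame X n y w₀ w₁) :
    area w₁ v₁ = -area v₀ w₀ := by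
  apply mul_left_cancel₀ hn
  have e0 := h.smul_snd_eq k 0
  have e1 := h.smul_snd_eq k 1
  have e := h.area_eq
  simp only [area] at *
  linear_combination v₁ 1 * e0 - v₁ 0 * e1 - (v₀ 0 * w₀ 1 - v₀ 1 * w₀ 0) * e

theorem eq_of_area_eq_zero (h : IsFrame X n x v₀ v₁) (k : IsFrame X m y w₀ w₁)
    (e : area v₀ w₀ = 0) : x = y := by
  have e1 : x 1 = y 1 := h.axis_snd.eq_of_area_eq_zero k.axis_snd e
  have e0 : x 0 = y 0 := by
    have := h.prod_eq.trans k.prod_eq.symm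
    rwa [e1, mul_left_inj] at this
  ext i
  fin_cases i
  · exact e0
  · exact e1

/-- Every orbit contains a pair whose second factor has an axis in the closed cone spanned by `v₀`
and `v₁`. -/
theorem exists_between (hn : 0 < n) (h : IsFrame X n x v₀ v₁) (k : IsFrame X n y w₀ w₁) :
    ∃ y' u₀ u₁, hurwitzOrbit y' = hurwitzOrbit y ∧ IsFrame X n y' u₀ u₁ ∧
      0 ≤ area v₀ u₀ ∧ 0 ≤ area u₀ v₁ := by
  induction hN : (area v₀ w₀).natAbs + (area w₀ v₁).natAbs using Nat.strong_induction_on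
    generalizing y w₀ w₁ with
  | _ N ih =>
  subst hN
  have hf := h.form_eq k
  have step : ∀ y' u₀ u₁, hurwitzOrbit y' = hurwitzOrbit y → IsFrame X n y' u₀ u₁ →
      (0 ≤ area v₀ u₀ * area u₀ v₁ ∨ (area v₀ u₀).natAbs + (area u₀ v₁).natAbs <
        (area v₀ w₀).natAbs + (area w₀ v₁).natAbs) →
      ∃ y' u₀ u₁, hurwitzOrbit y' = hurwitzOrbit y ∧ IsFrame X n y' u₀ u₁ ∧
        0 ≤ area v₀ u₀ ∧ 0 ≤ area u₀ v₁ := by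
    rintro y' u₀ u₁ ho hu (hc | hc)
    · rcases mul_nonneg_iff.1 hc with hc | hc
      · exact ⟨y', u₀, u₁, ho, hu, hc⟩
      · exact ⟨y', -u₀, -u₁, ho, hu.neg, by simp [area] at *; omega, by simp [area] at *; omega⟩
    · obtain ⟨y'', r₀, r₁, ho', hr⟩ := ih _ hc hu rfl
      exact ⟨y'', r₀, r₁, ho'.trans ho, hr⟩
  rcases le_or_gt 0 (area v₀ w₀ * area w₀ v₁) with hst | hst
  · exact step y w₀ w₁ rfl k (Or.inl hst)
  rcases le_total (area w₀ v₁).natAbs (area v₀ w₀).natAbs with hle | hle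
  · obtain ⟨y', ho, hy'⟩ := k.prev
    have e1 : area v₀ (n • w₀ - w₁) = -area w₀ v₁ := by
      have := h.area_fst_snd hn.ne' k
      simp [area] at *; linear_combination -this
    have e2 : area (n • w₀ - w₁) v₁ = area v₀ w₀ + n * area w₀ v₁ := by
      have := h.area_snd_snd hn.ne' k
      simp [area] at *; linear_combination -this
    refine step y' _ _ ho hy' ?_
    rw [e1, e2]
    generalize area v₀ w₀ = s at *
    generalize area w₀ v₁ = t at *
    exact (natAbs_add_mul_lt hn hf hst hle).imp_right (by omega)
  · obtain ⟨y', ho, hy'⟩ := k.next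
    have e1 := h.area_fst_snd hn.ne' k
    have e2 := h.area_snd_snd hn.ne' k
    refine step y' _ _ ho hy' ?_
    rw [e1, e2]
    generalize area v₀ w₀ = s at *
    generalize area w₀ v₁ = t at *
    rw [mul_comm (t + n * s)]
    exact (natAbs_add_mul_lt hn (by linear_combination hf) (by rwa [mul_comm]) hle).imp_right
      (by omega)

theorem exists_between_pos (hx : hurwitzOrbit x ≠ hurwitzOrbit y) (hn : 0 < n)
    (h : IsFrame X n x v₀ v₁) (k : IsFrame X n y w₀ w₁) :
    ∃ y' u₀ u₁, hurwitzOrbit y' = hurwitzOrbit y ∧ IsFrame X n y' u₀ u₁ ∧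
      0 < area v₀ u₀ ∧ 0 < area u₀ v₁ := by
  obtain ⟨y', u₀, u₁, ho, hu, hs, ht⟩ := h.exists_between hn k
  refine ⟨y', u₀, u₁, ho, hu, lt_of_le_of_ne hs fun e => hx ?_, lt_of_le_of_ne ht fun e => hx ?_⟩
  · rw [← ho, h.eq_of_area_eq_zero hu e.symm]
  -- If `w₀` is a multiple of `v₁`, compare with the next pair of the first orbit.
  · obtain ⟨x', ho', h'⟩ := h.next
    rw [← ho, ← ho', h'.eq_of_area_eq_zero hu]
    simp [area] at *; linarith

theorem orbit_eq_of_three (hn : 0 ≤ n) (h : IsFrame X n x v₀ v₁) (k : IsFrame X n y w₀ w₁)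
    (l : IsFrame X n z u₀ u₁) : hurwitzOrbit x = hurwitzOrbit y ∨ hurwitzOrbit x = hurwitzOrbit z ∨
      hurwitzOrbit y = hurwitzOrbit z := by
  by_contra! ⟨hxy, hxz, hyz⟩
  rcases hn.eq_or_lt with rfl | hn
  -- For `n = 0` the equation reads `s² + t² = 0`.
  · have := h.form_eq k
    have hs : area v₀ w₀ ^ 2 = 0 := by
      nlinarith [sq_nonneg (area v₀ w₀), sq_nonneg (area w₀ v₁)]
    exact hxy (congrArg _ (h.eq_of_area_eq_zero k (pow_eq_zero_iff two_ne_zero |>.1 hs)))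
  obtain ⟨y', w₀, w₁, hy, k', hs, ht⟩ := h.exists_between_pos hxy hn k
  obtain ⟨z', u₀, u₁, hz, l', hs', ht'⟩ := h.exists_between_pos hxz hn l
  rw [← hy, ← hz] at hyz
  obtain ⟨e, he⟩ := h.axis_snd.exists_area_eq_one
  have har := h.area_eq
  have plucker : ∀ p, area p v₁ = n * area p e - area v₁ e * area v₀ p := by
    intro p
    rw [← har]; simp only [area] at *
    linear_combination (-(p 0 * v₁ 1 - p 1 * v₁ 0)) * he
  have plucker' : ∀ p q, area p q = area p e * area v₀ q - area q e * area v₀ p := by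
    intro p q
    simp only [area] at *
    linear_combination (-(p 0 * q 1 - p 1 * q 0)) * he
  rcases lt_trichotomy 0 (area w₀ u₀) with hq | hq | hq
  · exact no_two_interlaced hn hs ht hs' ht' hq (h.form_eq k') (h.form_eq l') (plucker _)
      (plucker _) (plucker' _ _)
  · exact hyz (congrArg _ (k'.eq_of_area_eq_zero l' hq.symm))
  · have hq' : 0 < area u₀ w₀ := by simp [area] at *; linarith
    exact no_two_interlaced hn hs' ht' hs ht hq' (h.form_eq l') (h.form_eq k') (plucker _)
      (plucker _) (plucker' _ _)

end IsFrame

/-! ### Factorizations of elements of exponent sum two -/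

theorem exponentSum_of_isConj {a : B3} (h : IsConj sigma1 a) :
    exponentSum 3 a = Multiplicative.ofAdd 1 := by
  obtain ⟨c, rfl⟩ := isConj_iff.1 h
  rw [map_mul, map_mul, map_inv, mul_inv_cancel_comm]
  simp [exponentSum, sigma1]

theorem IsQuasipositiveFactorization.length_eq {X : B3} {k : ℕ} {x : Fin k → B3}
    (hx : IsQuasipositiveFactorization X x) :
    exponentSum 3 X = Multiplicative.ofAdd (k : ℤ) := by
  rw [← hx.1, map_list_prod, List.map_ofFn]
  have : (exponentSum 3 ∘ x) = fun _ => Multiplicative.ofAdd 1 :=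
    funext fun i => exponentSum_of_isConj (hx.2 i)
  rw [this, List.ofFn_const, List.prod_replicate, ← ofAdd_nsmul]
  simp

theorem IsQuasipositiveFactorization.exists_isFrame {X : B3} {x : Fin 2 → B3}
    (hx : IsQuasipositiveFactorization X x) : ∃ n v₀ v₁, 0 ≤ n ∧ IsFrame X n x v₀ v₁ := by
  obtain ⟨hp, hc⟩ := hx
  have ax : ∀ i, ∃ v, IsAxis (x i) v := fun i =>
    let ⟨c, hc⟩ := isConj_iff.1 (hc i); ⟨_, c, hc.symm, rfl⟩
  obtain ⟨v₁, h1⟩ := ax 0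
  obtain ⟨v₀, h0⟩ := ax 1
  have hp' : x 0 * x 1 = X := by simpa using hp
  rcases le_total 0 (area v₀ v₁) with h | h
  · exact ⟨_, v₀, v₁, h, hp', h1, h0, rfl⟩
  · exact ⟨_, -v₀, v₁, by simp [area] at *; linarith, hp', h1, h0.neg, rfl⟩

theorem theorem3 (X : B3) (hX : exponentSum 3 X = Multiplicative.ofAdd (2 : ℤ)) :
    (quasipositiveHurwitzOrbits X).encard ≤ 2 := by
  by_contra! hlt
  obtain ⟨t, hts, ht⟩ := Set.exists_subset_encard_eq (Order.add_one_le_of_lt hlt)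
  obtain ⟨A, B, C, hAB, hAC, hBC, rfl⟩ := Set.encard_eq_three.1 (ht.trans (by norm_num))
  have key : ∀ O ∈ quasipositiveHurwitzOrbits X, ∃ n x v₀ v₁, 0 ≤ n ∧ IsFrame X n x v₀ v₁ ∧
      O = hurwitzOrbit x := by
    rintro O ⟨k, x, hx, rfl⟩
    obtain rfl : k = 2 := by
      have := hx.length_eq.symm.trans hX
      exact_mod_cast Multiplicative.ofAdd.injective this
    obtain ⟨n, v₀, v₁, hn, h⟩ := hx.exists_isFrame
    exact ⟨n, x, v₀, v₁, hn, h, rfl⟩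
  obtain ⟨n, x, v₀, v₁, hn, h, rfl⟩ := key A (hts (by simp))
  obtain ⟨m, y, w₀, w₁, hm, k, rfl⟩ := key B (hts (by simp))
  obtain ⟨p, z, u₀, u₁, hp, l, rfl⟩ := key C (hts (by simp))
  have h1 := h.trace_eq
  have h2 := k.trace_eq
  have h3 := l.trace_eq
  obtain rfl : n = m := (sq_eq_sq₀ hn hm).1 (by linarith)
  obtain rfl : n = p := (sq_eq_sq₀ hn hp).1 (by linarith)
  rcases h.orbit_eq_of_three hn k l with e | e | e
  exacts [hAB e, hAC e, hBC e]
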